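/- For a topological space $X$ let $CL(X)$ be the set of all nonempty closed subsets of $X$, with the Vietoris topology $\tau_V$, i.e. the topology generated by the sets $$\langle U_1,\dots,U_k\rangle=\{H\in CL(X): H\subset U_1\cup\dots\cup U_k,\ H\cap U_j\neq\emptyset \text{ for } 1\le j\le k\},\qquad U_1,\dots,U_k\subset X\text{ open},\ k\ge 1.$$ A space $Y$ is quasi-metrizable if there is a function $d:Y\times Y\to[0,\infty)$ with $d(x,y)=0\iff x=y$ and $d(x,z)\le d(x,y)+d(y,z)$ for all $x,y,z\in Y$, such that the balls $\{y: d(x,y)<\varepsilon\}$ ($x\in Y$, $\varepsilon>0$) form a base of the topology of $Y$. A space $Y$ is a $\gamma$-space if one can assign to all $n\in\omega$ and $x\in Y$ an open set $g(n,x)$ such that $\{g(n,x):n\in\omega\}$ is a base at $x$ for every $x$, and for all $n,x$ there is $m\in\omega$ such that $y\in g(m,x)$ implies $g(m,y)\subset g(n,x)$. A subset $K$ of $Y$ has a countable base (in $Y$) if there are countably many open sets containing $K$ such that every open set containing $K$ contains one of them. Let $NI(X)$ be the set of non-isolated points of $X$. **Theorem.** For a Hausdorff space $X$ the following are equivalent: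 1. $(CL(X),\tau_V)$ is quasi-metrizable; 2. $(CL(X),\tau_V)$ is a $\gamma$-space; 3. every closed countably compact subset of $(CL(X),\tau_V)$ has a countable base in $(CL(X),\tau_V)$; 4. $X$ is separable and metrizable, and $NI(X)$ is compact. Moreover, there is a Hausdorff space $Y$ such that $(CL(Y),\tau_V)$ is quasi-metrizable but $Y$ is not homeomorphic to a topological sum $C\oplus D$ with $C$ compact metrizable and $D$ countable discrete. So it is not true that, for all $X$, $(CL(X),\tau_V)$ is quasi-metrizable if and only if $X$ is such a sum. -/

import Mathlib

open Set Topology TopologicalSpace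

/-- The hyperspace `CL(X)`: the set of all nonempty closed subsets of `X`. -/
def CL (X : Type*) [TopologicalSpace X] : Type _ :=
  {A : Set X // IsClosed A ∧ A.Nonempty}

namespace CL

variable {X : Type*} [TopologicalSpace X]

/-- `⟨U₁, …, U_k⟩`, the set of those `H` in `CL(X)` that are contained in `U₁ ∪ … ∪ U_k` and meet
every `U_j`; here `u = {U₁, …, U_k}`. -/
def basic (u : Set (Set X)) : Set (CL X) :=
  {H | H.1 ⊆ ⋃₀ u ∧ ∀ U ∈ u, (H.1 ∩ U).Nonempty}

/-- The Vietoris topology on `CL(X)`, generated by the sets `⟨U₁, …, U_k⟩`, `k ≥ 1`, `U_j` open. -/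
instance : TopologicalSpace (CL X) :=
  generateFrom {W | ∃ u : Set (Set X), u.Finite ∧ u.Nonempty ∧ (∀ U ∈ u, IsOpen U) ∧ W = basic u}

/-- The topology above is the one induced by Mathlib's Vietoris topology on all subsets. -/
theorem topology_eq_induced :
    (inferInstance : TopologicalSpace (CL X)) =
      (TopologicalSpace.vietoris X).induced (fun A : CL X => A.1) := by
  let _ := TopologicalSpace.vietoris X
  have h := (vietoris.isTopologicalBasis (α := X)).induced (fun A : CL X => A.1)
  apply le_antisymm
  · rw [@IsTopologicalBasis.eq_generateFrom _ (_) _ h]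
    refine le_generateFrom ?_
    rintro _ ⟨_, ⟨u, ⟨hu, ho⟩, rfl⟩, rfl⟩
    rcases u.eq_empty_or_nonempty with rfl | hne
    · convert isOpen_empty
      ext A
      have hA := A.2.2.ne_empty
      simp [hA]
    · exact isOpen_generateFrom_of_mem ⟨u, hu, hne, ho, rfl⟩
  · refine le_generateFrom ?_
    rintro _ ⟨u, hu, -, ho, rfl⟩
    exact ⟨_, vietoris.isTopologicalBasis.isOpen ⟨u, ⟨hu, ho⟩, rfl⟩, rfl⟩

end CL

/-- A quasi-metric: a metric without the symmetry axiom. -/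
structure IsQuasiMetric {Y : Type*} (d : Y → Y → ℝ) : Prop where
  nonneg : ∀ x y, 0 ≤ d x y
  eq_zero_iff : ∀ x y, d x y = 0 ↔ x = y
  triangle : ∀ x y z, d x z ≤ d x y + d y z

/-- `Y` is quasi-metrizable: for some quasi-metric, the balls `{y | d x y < ε}` form a base of the
topology. -/
def QuasiMetrizable (Y : Type*) [TopologicalSpace Y] : Prop :=
  ∃ d : Y → Y → ℝ, IsQuasiMetric d ∧
    IsTopologicalBasis {B : Set Y | ∃ (x : Y) (ε : ℝ), 0 < ε ∧ B = {y | d x y < ε}}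

/-- `Y` is a γ-space. -/
def IsGammaSpace (Y : Type*) [TopologicalSpace Y] : Prop :=
  ∃ g : ℕ → Y → Set Y,
    (∀ n x, IsOpen (g n x)) ∧
    (∀ x, (𝓝 x).HasBasis (fun _ : ℕ => True) (fun n => g n x)) ∧
    ∀ n x, ∃ m, ∀ y ∈ g m x, g m y ⊆ g n x

/-- The subset `K` has a countable base in `Y` (countable character): countably many open
sets containing `K` such that every open set containing `K` contains one of them. -/
def HasCountableBaseIn {Y : Type*} [TopologicalSpace Y] (K : Set Y) : Prop :=
  ∃ U : ℕ → Set Y, (∀ n, IsOpen (U n) ∧ K ⊆ U n) ∧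
    ∀ V : Set Y, IsOpen V → K ⊆ V → ∃ n, U n ⊆ V

/-- `NI(X)`, the set of non-isolated points of `X`. -/
def NI (X : Type*) [TopologicalSpace X] : Set X := {x | ¬ IsOpen ({x} : Set X)}

/-- `X = C ⊕ D` with `C` compact metrizable and `D` countable discrete. -/
def IsCompactSumCountableDiscrete (X : Type) [TopologicalSpace X] : Prop :=
  ∃ (C D : Type) (_ : TopologicalSpace C) (_ : TopologicalSpace D),
    CompactSpace C ∧ MetrizableSpace C ∧ Countable D ∧ DiscreteTopology D ∧ Nonempty (X ≃ₜ C ⊕ D)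

/-! A Vietoris neighbourhood bounds a closed set from above by an open superset and from below by
finitely many open sets it must meet.

From 3 to 4, countable bases at the points of `CL X` make every closed subset of `X` separable and
of countable character. Countable character forces regularity and excludes an infinite closed
discrete set of non-isolated points, so `NI X` is countably compact. Its singletons then have a
countable base in `CL X`, which pulls back along `(x, y) ↦ {x, y}` to one for the diagonal of `NI
X`; with separability this gives second countability (`secondCountableTopology_of_diag`).

From 4 to 1 (`quasiMetrizable_CL`), `B` is `ε`-close to `A` if it lies in `A` enlarged by `ε` around
`A ∩ NI X` and meets the early base sets that `A` meets. Isolated points need no enlargement, and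
compactness of `A ∩ NI X` fits the enlargement into any open superset of `A`.

The counterexample is a fan whose only non-isolated point has no compact neighbourhood. -/

open Filter

/-! ### Vietoris topology: subbasic sets, separation, singletons -/

namespace CL

variable {X : Type*} [TopologicalSpace X]

theorem isOpen_basic {u : Set (Set X)} (hu : u.Finite) (hne : u.Nonempty)
    (ho : ∀ U ∈ u, IsOpen U) : IsOpen (basic u) :=
  isOpen_generateFrom_of_mem ⟨u, hu, hne, ho, rfl⟩

theorem isOpen_subset {U : Set X} (hU : IsOpen U) : IsOpen {H : CL X | H.1 ⊆ U} := by
  convert isOpen_basic (finite_singleton U) (singleton_nonempty U) (by simpa using hU) using 1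
  ext H
  simp only [basic, sUnion_singleton, mem_singleton_iff, forall_eq, mem_ofPred_eq]
  refine ⟨fun h => ⟨h, ?_⟩, fun h => h.1⟩
  rw [inter_eq_self_of_subset_left h]
  exact H.2.2

theorem isOpen_hits {U : Set X} (hU : IsOpen U) : IsOpen {H : CL X | (H.1 ∩ U).Nonempty} := by
  convert isOpen_basic (u := {U, univ}) (by simp) (by simp) (by simpa using hU) using 1
  ext H
  have := H.2.2
  simp [basic, this]

/-- The sets `⟨U₁, …, U_k⟩` form a base. -/
theorem exists_basic_subset {W : Set (CL X)} (hW : IsOpen W) {H : CL X} (hH : H ∈ W) :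
    ∃ u : Set (Set X), u.Finite ∧ (∀ U ∈ u, IsOpen U) ∧ H ∈ basic u ∧ basic u ⊆ W := by
  let _ := TopologicalSpace.vietoris X
  have h := (vietoris.isTopologicalBasis (α := X)).induced (fun A : CL X => A.1)
  rw [← topology_eq_induced] at h
  obtain ⟨_, ⟨_, ⟨u, ⟨hu, ho⟩, rfl⟩, rfl⟩, hHu, huW⟩ := h.exists_subset_of_mem_open hH hW
  exact ⟨u, hu, ho, hHu, huW⟩

instance [T1Space X] : T1Space (CL X) := by
  refine ⟨fun H => ?_⟩
  have : ({H} : Set (CL X)) = {A | (A.1 ∩ H.1ᶜ).Nonempty}ᶜ ∩ ⋂ x ∈ H.1, {A | A.1 ⊆ {x}ᶜ}ᶜ := by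
    ext A
    simp only [mem_singleton_iff, mem_inter_iff, mem_compl_iff, mem_ofPred_eq, mem_iInter,
      not_nonempty_iff_eq_empty, subset_compl_singleton_iff, not_not]
    refine ⟨fun h => by simp [h], fun h => Subtype.ext (Subset.antisymm ?_ h.2)⟩
    rw [← sdiff_eq, sdiff_eq_empty] at h
    exact h.1
  rw [this]
  refine (isOpen_hits H.2.1.isOpen_compl).isClosed_compl.inter ?_
  exact isClosed_biInter fun x _ => (isOpen_subset isOpen_compl_singleton).isClosed_compl

/-- The embedding of `X` into `CL X` by singletons. -/
def single [T1Space X] (x : X) : CL X := ⟨{x}, isClosed_singleton, singleton_nonempty x⟩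

theorem continuous_single [T1Space X] : Continuous (single : X → CL X) := by
  refine continuous_generateFrom_iff.2 ?_
  rintro _ ⟨u, hu, -, ho, rfl⟩
  have : single ⁻¹' basic u = ⋃₀ u ∩ ⋂ U ∈ u, U := by
    ext x
    simp [single, basic]
  rw [this]
  exact (isOpen_sUnion ho).inter (hu.isOpen_biInter ho)

theorem isClosed_image_single [T2Space X] {K : Set X} (hK : IsClosed K) :
    IsClosed (single '' K : Set (CL X)) := by
  rw [← isOpen_compl_iff, isOpen_iff_mem_nhds]
  intro A hA
  obtain ⟨a, ha⟩ := A.2.2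
  by_cases hs : A.1 ⊆ {a}
  · have hAa : A = single a := Subtype.ext (Subset.antisymm hs (singleton_subset_iff.2 ha))
    have haK : a ∉ K := fun h => hA ⟨a, h, hAa.symm⟩
    filter_upwards [(isOpen_subset hK.isOpen_compl).mem_nhds
      (show A.1 ⊆ Kᶜ from hs.trans (by simp [haK]))]
    rintro _ hB ⟨x, hx, rfl⟩
    exact hB rfl hx
  · obtain ⟨b, hb, hba⟩ := not_subset.1 hs
    -- No singleton meets two disjoint open sets.
    obtain ⟨U, V, hU, hV, haU, hbV, hUV⟩ := t2_separation (Ne.symm hba)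
    filter_upwards [(isOpen_hits hU).mem_nhds (show (A.1 ∩ U).Nonempty from ⟨a, ha, haU⟩),
      (isOpen_hits hV).mem_nhds (show (A.1 ∩ V).Nonempty from ⟨b, hb, hbV⟩)]
    rintro _ ⟨p, hp, hpU⟩ ⟨q, hq, hqV⟩ ⟨x, -, rfl⟩
    obtain rfl : p = x := hp
    obtain rfl : q = p := hq
    exact disjoint_left.1 hUV hpU hqV

end CL

/-! ### Quasi-metrics and γ-spaces -/

theorem QuasiMetrizable.isGammaSpace {Y : Type*} [TopologicalSpace Y] (h : QuasiMetrizable Y) :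
    IsGammaSpace Y := by
  obtain ⟨d, hd, hb⟩ := h
  have hpos (n : ℕ) : (0 : ℝ) < (1 / 2) ^ n := by positivity
  refine ⟨fun n x => {y | d x y < (1 / 2) ^ n}, fun n x => hb.isOpen ⟨x, _, hpos n, rfl⟩,
    fun x => ?_, fun n x => ⟨n + 1, fun y hy z hz => ?_⟩⟩
  · refine ⟨fun s => ⟨fun hs => ?_, ?_⟩⟩
    · obtain ⟨_, ⟨y, ε, hε, rfl⟩, hx, hys⟩ := hb.mem_nhds_iff.1 hs
      -- The basic ball is centred at `y`, so the radius at `x` must be below `ε - d y x`.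
      obtain ⟨n, hn⟩ := exists_pow_lt_of_lt_one (sub_pos.2 hx) (by norm_num : (1 / 2 : ℝ) < 1)
      refine ⟨n, trivial, fun z hz => hys ?_⟩
      have := hd.triangle y x z
      simp only [mem_ofPred_eq] at hz ⊢
      linarith
    · rintro ⟨n, -, hn⟩
      refine mem_of_superset ((hb.isOpen ⟨x, _, hpos n, rfl⟩).mem_nhds ?_) hn
      simp [(hd.eq_zero_iff x x).2 rfl]
  · have := hd.triangle x y z
    simp only [mem_ofPred_eq, pow_succ] at hy hz ⊢
    linarith

/-- If every union of `G n x` over `K` leaves `V`, the centres of the escaping points cluster at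
some `a ∈ K`, and the γ-condition at `a` pulls one of these points back into `V`. -/
theorem IsGammaSpace.hasCountableBaseIn {Y : Type*} [TopologicalSpace Y] (h : IsGammaSpace Y)
    {K : Set Y} (hK : IsCountablyCompact K) : HasCountableBaseIn K := by
  obtain ⟨g, hgo, hgb, hgγ⟩ := h
  let G : ℕ → Y → Set Y := fun n x => ⋂ i ∈ Iic n, g i x
  have hGo (n x) : IsOpen (G n x) := (finite_Iic n).isOpen_biInter fun i _ => hgo i x
  have hxG (n x) : x ∈ G n x := mem_iInter₂.2 fun i _ => mem_of_mem_nhds ((hgb x).mem_of_mem trivial)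
  have hG {i n : ℕ} (hin : i ≤ n) (x) : G n x ⊆ g i x := biInter_subset_of_mem hin
  refine ⟨fun n => ⋃ x ∈ K, G n x, fun n => ⟨isOpen_biUnion fun x _ => hGo n x,
    fun x hx => mem_biUnion hx (hxG n x)⟩, fun V hV hKV => ?_⟩
  by_contra! hcon
  have hcon' (n : ℕ) : ∃ x ∈ K, ∃ y ∈ G n x, y ∉ V := by
    obtain ⟨y, hy, hyV⟩ := not_subset.1 (hcon n)
    obtain ⟨x, hx, hyx⟩ := mem_iUnion₂.1 hy
    exact ⟨x, hx, y, hyx, hyV⟩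
  choose x hx y hyx hyV using hcon'
  obtain ⟨a, ha, hax⟩ := hK.seq_clusterPt x (Eventually.of_forall hx)
  obtain ⟨k, -, hk⟩ := (hgb a).mem_iff.1 (hV.mem_nhds (hKV ha))
  obtain ⟨m, hm⟩ := hgγ k a
  obtain ⟨n, hmn, hn⟩ :=
    frequently_atTop.1 (hax.frequently ((hgb a).mem_of_mem (i := m) trivial)) m
  exact hyV n (hk (hm _ hn (hG hmn _ (hyx n))))

/-- Quasi-metrization by a real-indexed family of relations. -/
theorem QuasiMetrizable.of_relations {Y : Type*} [TopologicalSpace Y] [T1Space Y]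
    (E : ℝ → Y → Y → Prop) (hrefl : ∀ ε x, 0 < ε → E ε x x) (htop : ∀ x y, E 1 x y)
    (htri : ∀ ε δ x y z, 0 < ε → 0 < δ → E ε x y → E δ y z → E (ε + δ) x z)
    (hmono : ∀ ε δ x y, 0 < ε → ε ≤ δ → E ε x y → E δ x y)
    (hb : ∀ x, (𝓝 x).HasBasis (fun ε : ℝ => 0 < ε) fun ε => {y | E ε x y}) :
    QuasiMetrizable Y := by
  -- The quasi-metric is the infimum of `S x y`.
  let S : Y → Y → Set ℝ := fun x y => {ε | 0 < ε ∧ E ε x y}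
  have hbdd (x y) : BddBelow (S x y) := ⟨0, fun ε h => h.1.le⟩
  have hne (x y) : (S x y).Nonempty := ⟨1, one_pos, htop x y⟩
  have hlt {x y ε} (h : sInf (S x y) < ε) : E ε x y := by
    obtain ⟨δ, hδ, hδε⟩ := (csInf_lt_iff (hbdd x y) (hne x y)).1 h
    exact hmono δ ε x y hδ.1 hδε.le hδ.2
  have hle {x y ε} (h0 : 0 < ε) (h : E ε x y) : sInf (S x y) ≤ ε := csInf_le (hbdd x y) ⟨h0, h⟩
  have hnn (x y) : 0 ≤ sInf (S x y) := le_csInf (hne x y) fun ε h => h.1.le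
  have hd : IsQuasiMetric fun x y => sInf (S x y) := by
    refine ⟨hnn, fun x y => ⟨fun h => ?_, ?_⟩, fun x y z => ?_⟩
    · by_contra hxy
      obtain ⟨ε, hε, hs⟩ := (hb x).mem_iff.1 (isOpen_compl_singleton.mem_nhds hxy)
      exact hs (hlt (h.trans_lt hε)) rfl
    · rintro rfl
      refine le_antisymm (le_of_forall_pos_le_add fun ε hε => ?_) (hnn x x)
      simpa using hle hε (hrefl ε x hε)
    · refine le_of_forall_pos_le_add fun ε hε => ?_
      have h1 : E (sInf (S x y) + ε / 2) x y := hlt (by linarith)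
      have h2 : E (sInf (S y z) + ε / 2) y z := hlt (by linarith)
      have := hnn x y
      have := hnn y z
      have := hle (by linarith) (htri _ _ _ _ _ (by linarith) (by linarith) h1 h2)
      linarith
  refine ⟨_, hd, isTopologicalBasis_of_isOpen_of_nhds ?_ ?_⟩
  · rintro _ ⟨x, ε, -, rfl⟩
    refine isOpen_iff_mem_nhds.2 fun y hy => ?_
    have hδ : 0 < (ε - sInf (S x y)) / 2 := half_pos (sub_pos.2 hy)
    filter_upwards [(hb y).mem_of_mem hδ] with z hz
    have h1 := hd.triangle x y z
    have h2 := hle hδ hz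
    simp only [mem_ofPred_eq] at hy h1 ⊢
    linarith
  · intro x U hx hU
    obtain ⟨ε, hε, hs⟩ := (hb x).mem_iff.1 (hU.mem_nhds hx)
    refine ⟨_, ⟨x, ε, hε, rfl⟩, ?_, fun y hy => hs (hlt hy)⟩
    simpa [(hd.eq_zero_iff x x).2 rfl] using hε

/-! ### Spaces whose closed sets have countable character -/

theorem HasCountableBaseIn.isCountablyGenerated_nhdsSet {Y : Type*} [TopologicalSpace Y]
    {K : Set Y} (h : HasCountableBaseIn K) : (𝓝ˢ K).IsCountablyGenerated := by
  obtain ⟨U, hU, hV⟩ := h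
  have : (𝓝ˢ K).HasBasis (fun _ : ℕ => True) U := by
    refine ⟨fun t => ?_⟩
    rw [mem_nhdsSet_iff_exists]
    constructor
    · rintro ⟨V, hVo, hKV, hVt⟩
      obtain ⟨n, hn⟩ := hV V hVo hKV
      exact ⟨n, trivial, hn.trans hVt⟩
    · rintro ⟨n, -, hn⟩
      exact ⟨U n, (hU n).1, (hU n).2, hn⟩
  exact this.isCountablyGenerated

/-- Otherwise some sequence tends both to `x` and to `F`; a tail of it with `x` added is closed and
misses `F`, a contradiction. -/
theorem regularSpace_of_hasCountableBaseIn {X : Type*} [TopologicalSpace X] [T2Space X]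
    (h : ∀ F : Set X, IsClosed F → HasCountableBaseIn F) : RegularSpace X := by
  refine ⟨fun {F x} hF hx => ?_⟩
  have h1 := (h F hF).isCountablyGenerated_nhdsSet
  have h2 := (h {x} isClosed_singleton).isCountablyGenerated_nhdsSet
  rw [nhdsSet_singleton] at h2
  by_contra hd
  rw [disjoint_iff] at hd
  have : NeBot (𝓝ˢ F ⊓ 𝓝 x) := ⟨hd⟩
  obtain ⟨z, hz⟩ := exists_seq_tendsto (𝓝ˢ F ⊓ 𝓝 x)
  obtain ⟨hzF, hzx⟩ := tendsto_inf.1 hz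
  obtain ⟨N, hN⟩ := eventually_atTop.1 (hzx.eventually (hF.isOpen_compl.mem_nhds hx))
  have hS := ((tendsto_add_atTop_iff_nat N).2 hzx).isCompact_insert_range.isClosed
  have hSF : (insert x (range fun n => z (n + N)))ᶜ ∈ 𝓝ˢ F := by
    refine hS.isOpen_compl.mem_nhdsSet.2 fun y hy hyS => ?_
    rcases hyS with rfl | ⟨n, rfl⟩
    · exact hx hy
    · exact hN _ (Nat.le_add_left N n) hy
  obtain ⟨n, hn⟩ := (((tendsto_add_atTop_iff_nat N).2 hzF).eventually hSF).exists
  exact hn (Or.inr ⟨n, rfl⟩)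

theorem isClosed_NI (X : Type*) [TopologicalSpace X] : IsClosed (NI X) := by
  have : (NI X)ᶜ = ⋃ x ∈ (NI X)ᶜ, {x} := (biUnion_of_singleton _).symm
  rw [← isOpen_compl_iff, this]
  exact isOpen_biUnion fun x hx => by simpa [NI] using hx

theorem isCountablyCompact_NI {X : Type*} [TopologicalSpace X] [T1Space X] [RegularSpace X]
    (h : ∀ F : Set X, IsClosed F → HasCountableBaseIn F) : IsCountablyCompact (NI X) := by
  rw [isCountablyCompact_iff_infinite_subset_has_accPt]
  intro B hB hinf
  by_contra! hacc
  have hacc' (a : X) : ¬ AccPt a (𝓟 B) := fun ha => hacc a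
    ((isClosed_NI X).closure_subset_iff.2 hB ha.clusterPt.mem_closure) ha
  have hcl (C : Set X) (hC : C ⊆ B) : IsClosed C :=
    isClosed_iff_accPt.2 fun a ha => (hacc' a (ha.mono (principal_mono.2 hC))).elim
  let x : ℕ → X := fun n => hinf.natEmbedding B n
  have hxB (n) : x n ∈ B := (hinf.natEmbedding B n).2
  have hxi : Function.Injective x := Subtype.val_injective.comp (hinf.natEmbedding B).injective
  obtain ⟨U, hU, hUb⟩ := h (range x) (hcl _ (range_subset_iff.2 hxB))
  have hC (n : ℕ) : ∃ C ∈ 𝓝 (x n), IsClosed C ∧ C ⊆ (B \ {x n})ᶜ :=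
    exists_mem_nhds_isClosed_subset
      ((hcl _ sdiff_subset).isOpen_compl.mem_nhds (by simp))
  choose C hCx hCc hCB using hC
  have hCm {m n : ℕ} (hmn : m ≠ n) : x m ∉ C n := fun hm =>
    hCB n hm ⟨hxB m, fun h => hmn (hxi h)⟩
  -- The `O n` are pairwise disjoint, so `O m` contains no `y n` but `y m`; hence `x m` is not in
  -- the closure of the `y n`, although every `U n` contains `y n`.
  let O : ℕ → Set X := fun n => C n ∩ ⋂ m ∈ Iio n, (C m)ᶜ
  have hO (n) : O n ∈ 𝓝 (x n) := inter_mem (hCx n) <| (biInter_mem (finite_Iio n)).2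
    fun m hm => (hCc m).isOpen_compl.mem_nhds (hCm (ne_of_gt hm))
  have hy (n : ℕ) : ∃ y, y ∈ O n ∧ y ∈ U n ∧ y ≠ x n := by
    have : NeBot (𝓝[≠] x n) := by
      rw [neBot_iff]
      exact fun h => hB (hxB n) (isOpen_singleton_iff_punctured_nhds _ |>.2 h)
    have hmem : O n ∩ U n ∩ {x n}ᶜ ∈ 𝓝[≠] x n := inter_mem (mem_nhdsWithin_of_mem_nhds
      (inter_mem (hO n) ((hU n).1.mem_nhds ((hU n).2 (mem_range_self n))))) self_mem_nhdsWithin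
    obtain ⟨y, ⟨hyO, hyU⟩, hyn⟩ := Filter.nonempty_of_mem hmem
    exact ⟨y, hyO, hyU, hyn⟩
  choose y hyO hyU hyx using hy
  have hxy : range x ⊆ (closure (range y))ᶜ := by
    rintro _ ⟨m, rfl⟩ hm
    obtain ⟨_, ⟨hzO, hzy⟩, n, rfl⟩ := mem_closure_iff_nhds.1 hm _
      (inter_mem (hO m) (isOpen_compl_singleton.mem_nhds (hyx m).symm))
    rcases lt_trichotomy n m with hnm | rfl | hnm
    · exact mem_iInter₂.1 hzO.2 n hnm (hyO n).1
    · exact hzy rfl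
    · exact mem_iInter₂.1 (hyO n).2 m hnm hzO.1
  obtain ⟨n, hn⟩ := hUb _ isClosed_closure.isOpen_compl hxy
  exact hn (hyU n) (subset_closure (mem_range_self n))

/-! ### Passing from `CL X` to `X` -/

namespace CL

variable {X : Type*} [TopologicalSpace X] [T1Space X]

theorem hasCountableBaseIn_of_singleton {H : CL X} (h : HasCountableBaseIn {H}) :
    HasCountableBaseIn H.1 := by
  obtain ⟨W, hW, hWb⟩ := h
  choose u hu huo hHu huW using fun n => exists_basic_subset (hW n).1 ((hW n).2 rfl)
  refine ⟨fun n => ⋃₀ u n, fun n => ⟨isOpen_sUnion (huo n), (hHu n).1⟩, fun V hV hHV => ?_⟩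
  obtain ⟨n, hn⟩ := hWb _ (isOpen_subset hV) (singleton_subset_iff.2 hHV)
  refine ⟨n, fun x hx => ?_⟩
  -- Adding a point of `⋃₀ u n` to `H` does not leave `basic (u n)`.
  have : (⟨insert x H.1, by
      simpa using (isClosed_singleton (x := x)).union H.2.1, insert_nonempty _ _⟩ : CL X) ∈
      basic (u n) :=
    ⟨insert_subset hx (hHu n).1, fun U hU =>
      ((hHu n).2 U hU).mono (inter_subset_inter_left _ (subset_insert _ _))⟩
  exact hn (huW n this) (mem_insert _ _)

theorem exists_countable_dense_of_singleton {H : CL X} (h : HasCountableBaseIn {H}) :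
    ∃ D ⊆ H.1, D.Countable ∧ H.1 ⊆ closure D := by
  obtain ⟨W, hW, hWb⟩ := h
  choose u hu huo hHu huW using fun n => exists_basic_subset (hW n).1 ((hW n).2 rfl)
  have : Nonempty X := ⟨H.2.2.some⟩
  choose! p hpH hpU using fun n => (hHu n).2
  refine ⟨⋃ n, p n '' u n, iUnion_subset fun n => image_subset_iff.2 (hpH n),
    countable_iUnion fun n => ((hu n).image _).countable, fun x hx => ?_⟩
  refine mem_closure_iff.2 fun O hO hxO => ?_
  obtain ⟨n, hn⟩ := hWb _ (isOpen_hits hO) (singleton_subset_iff.2 ⟨x, hx, hxO⟩)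
  have hne : (u n).Nonempty := by
    obtain ⟨U, hU, -⟩ := (hHu n).1 hx
    exact ⟨U, hU⟩
  -- The finite set of chosen points is itself in `W n`, so it meets `O`.
  have : (⟨p n '' u n, ((hu n).image _).isClosed, hne.image _⟩ : CL X) ∈ basic (u n) :=
    ⟨image_subset_iff.2 fun U hU => ⟨U, hU, hpU n U hU⟩,
      fun U hU => ⟨p n U, mem_image_of_mem _ hU, hpU n U hU⟩⟩
  obtain ⟨y, hy, hyO⟩ := hn (huW n this)
  exact ⟨y, hyO, mem_iUnion.2 ⟨n, hy⟩⟩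

/-- The two-point set `{x, y}`. -/
def pair (p : X × X) : CL X := ⟨{p.1, p.2}, (toFinite _).isClosed, insert_nonempty _ _⟩

theorem continuous_pair : Continuous (pair : X × X → CL X) := by
  refine continuous_generateFrom_iff.2 ?_
  rintro _ ⟨u, hu, -, ho, rfl⟩
  have : pair ⁻¹' basic u = (Prod.fst ⁻¹' ⋃₀ u ∩ Prod.snd ⁻¹' ⋃₀ u) ∩
      ⋂ U ∈ u, (Prod.fst ⁻¹' U ∪ Prod.snd ⁻¹' U) := by
    ext p
    have hhit (U : Set X) : (({p.1, p.2} : Set X) ∩ U).Nonempty ↔ p.1 ∈ U ∨ p.2 ∈ U := by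
      simp [Set.Nonempty]
    change ({p.1, p.2} : Set X) ⊆ ⋃₀ u ∧ (∀ U ∈ u, (({p.1, p.2} : Set X) ∩ U).Nonempty) ↔ _
    simp only [hhit, insert_subset_iff, singleton_subset_iff, mem_inter_iff, mem_iInter,
      mem_union, mem_preimage]
  rw [this]
  have h := isOpen_sUnion ho
  exact ((h.preimage continuous_fst).inter (h.preimage continuous_snd)).inter <|
    hu.isOpen_biInter fun U hU =>
      ((ho U hU).preimage continuous_fst).union ((ho U hU).preimage continuous_snd)

theorem hasCountableBaseIn_diag {K : Set X}
    (h : HasCountableBaseIn (single '' K : Set (CL X))) :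
    HasCountableBaseIn ((fun x => (x, x)) '' K : Set (X × X)) := by
  obtain ⟨W, hW, hWb⟩ := h
  refine ⟨fun n => pair ⁻¹' W n, fun n => ⟨(hW n).1.preimage continuous_pair, ?_⟩,
    fun V hV hKV => ?_⟩
  · rintro _ ⟨x, hx, rfl⟩
    have : pair (x, x) = single x := Subtype.ext (by simp [pair, single])
    rw [mem_preimage, this]
    exact (hW n).2 (mem_image_of_mem _ hx)
  · obtain ⟨n, hn⟩ := hWb (⋃ U ∈ {U : Set X | IsOpen U ∧ U ×ˢ U ⊆ V}, {H | H.1 ⊆ U})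
      (isOpen_biUnion fun U hU => isOpen_subset hU.1) (by
        rintro _ ⟨x, hx, rfl⟩
        obtain ⟨A, B, hA, hB, hxA, hxB, hAB⟩ :=
          isOpen_prod_iff.1 hV x x (hKV (mem_image_of_mem _ hx))
        exact mem_biUnion (x := A ∩ B) ⟨hA.inter hB,
          (prod_mono inter_subset_left inter_subset_right).trans hAB⟩
          (singleton_subset_iff.2 ⟨hxA, hxB⟩))
    refine ⟨n, fun p hp => ?_⟩
    obtain ⟨U, hU, hpU⟩ := mem_iUnion₂.1 (hn hp)
    exact hU.2 ⟨hpU (mem_insert _ _), hpU (mem_insert_of_mem _ rfl)⟩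

end CL

/-- Slices of the `V n` at points of `D` form a base at non-isolated points; isolated points belong
to every dense set, so they are countably many. -/
theorem secondCountableTopology_of_diag {X : Type*} [TopologicalSpace X] [RegularSpace X]
    [SeparableSpace X] {D : Set X} (hD : D.Countable) (hKD : NI X ⊆ closure D)
    (h : HasCountableBaseIn ((fun x => (x, x)) '' NI X : Set (X × X))) :
    SecondCountableTopology X := by
  obtain ⟨V, hV, hVb⟩ := h
  obtain ⟨S, hS, hSd⟩ := exists_countable_dense X
  have hslice (n d) : IsOpen {y | (d, y) ∈ V n} :=
    (hV n).1.preimage (Continuous.prodMk_right d)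
  have hslice' (n y) : IsOpen {d | (d, y) ∈ V n} :=
    (hV n).1.preimage (Continuous.prodMk_left y)
  refine (isTopologicalBasis_of_isOpen_of_nhds
    (s := (⋃ n : ℕ, (fun d => {y | (d, y) ∈ V n}) '' D) ∪ {s | ∃ x ∈ S, IsOpen {x} ∧ s = {x}})
    ?_ ?_).secondCountableTopology ?_
  · rintro s (hs | ⟨x, -, hx, rfl⟩)
    · obtain ⟨n, d, -, rfl⟩ := mem_iUnion.1 hs
      exact hslice n d
    · exact hx
  · intro x O hx hO
    by_cases hxK : x ∈ NI X
    · obtain ⟨P, hPx, hPc, hPO⟩ := exists_mem_nhds_isClosed_subset (hO.mem_nhds hx)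
      -- Over a point of `P`, a slice of this open set is just `O`.
      obtain ⟨m, hm⟩ := hVb (Pᶜ ×ˢ univ ∪ univ ×ˢ O)
        ((hPc.isOpen_compl.prod isOpen_univ).union (isOpen_univ.prod hO)) (by
          rintro _ ⟨y, -, rfl⟩
          by_cases hy : y ∈ P
          · exact Or.inr ⟨trivial, hPO hy⟩
          · exact Or.inl ⟨hy, trivial⟩)
      obtain ⟨d, ⟨hdV, hdP⟩, hdD⟩ := mem_closure_iff_nhds.1 (hKD hxK) _
        (inter_mem ((hslice' m x).mem_nhds ((hV m).2 (mem_image_of_mem _ hxK))) hPx)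
      refine ⟨_, Or.inl (mem_iUnion.2 ⟨m, d, hdD, rfl⟩), hdV, fun y hy => ?_⟩
      rcases hm hy with h | h
      · exact (h.1 hdP).elim
      · exact h.2
    · have hxo : IsOpen {x} := by simpa [NI] using hxK
      obtain ⟨y, hy, hyS⟩ := hSd.inter_open_nonempty _ hxo (singleton_nonempty x)
      obtain rfl : y = x := hy
      exact ⟨{y}, Or.inr ⟨y, hyS, hxo, rfl⟩, rfl, singleton_subset_iff.2 hx⟩
  · refine (countable_iUnion fun n => hD.image _).union ((hS.image singleton).mono ?_)
    rintro _ ⟨x, hx, -, rfl⟩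
    exact ⟨x, hx, rfl⟩

theorem separable_metrizable_isCompact_NI {X : Type*} [TopologicalSpace X] [T2Space X]
    (h : ∀ K : Set (CL X), IsClosed K → IsCountablyCompact K → HasCountableBaseIn K) :
    SeparableSpace X ∧ MetrizableSpace X ∧ IsCompact (NI X) := by
  have hpt (H : CL X) : HasCountableBaseIn {H} :=
    h _ isClosed_singleton isCountablyCompact_singleton
  have hF (F : Set X) (hF : IsClosed F) : HasCountableBaseIn F := by
    rcases F.eq_empty_or_nonempty with rfl | hne
    · exact ⟨fun _ => ∅, by simp, by simp⟩
    · exact CL.hasCountableBaseIn_of_singleton (hpt ⟨F, hF, hne⟩)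
  have hD (F : Set X) (hF : IsClosed F) : ∃ D ⊆ F, D.Countable ∧ F ⊆ closure D := by
    rcases F.eq_empty_or_nonempty with rfl | hne
    · exact ⟨∅, by simp⟩
    · exact CL.exists_countable_dense_of_singleton (hpt ⟨F, hF, hne⟩)
  have hreg := regularSpace_of_hasCountableBaseIn hF
  have hsep : SeparableSpace X := by
    obtain ⟨D, -, hDc, hD⟩ := hD univ isClosed_univ
    exact ⟨D, hDc, fun x => hD (mem_univ x)⟩
  have hcc := isCountablyCompact_NI hF
  obtain ⟨D, -, hDc, hD⟩ := hD (NI X) (isClosed_NI X)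
  have := secondCountableTopology_of_diag hDc hD <| CL.hasCountableBaseIn_diag <|
    h _ (CL.isClosed_image_single (isClosed_NI X)) (hcc.image CL.continuous_single)
  exact ⟨hsep, inferInstance, hcc.isCompact⟩

/-! ### The quasi-metric on `CL X` -/

open Metric in
/-- If `X` is separable and metrizable with `NI X` compact, then `CL X` is quasi-metrizable. -/
theorem quasiMetrizable_CL {X : Type*} [TopologicalSpace X] [SeparableSpace X]
    [MetrizableSpace X] (hK : IsCompact (NI X)) : QuasiMetrizable (CL X) := by
  let _ := metrizableSpaceMetric X
  have : SecondCountableTopology X := UniformSpace.secondCountable_of_separable X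
  obtain ⟨O, hO⟩ : ∃ O : ℕ → Set X, IsTopologicalBasis (range O) := by
    obtain ⟨b, hb, -, hbb⟩ := exists_countable_basis X
    have hne : b.Nonempty ∨ b = ∅ := b.eq_empty_or_nonempty.symm
    rcases hne with hne | rfl
    · obtain ⟨O, rfl⟩ := hb.exists_eq_range hne
      exact ⟨O, hbb⟩
    · have hX : IsEmpty X := by
        simpa [eq_comm (a := (∅ : Set X)), univ_eq_empty_iff] using hbb.sUnion_eq
      exact ⟨fun _ => ∅, isTopologicalBasis_of_isOpen_of_nhds (by simp)
        fun x => (IsEmpty.false x).elim⟩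
  have hOo (n) : IsOpen (O n) := hO.isOpen (mem_range_self n)
  have hopen (A : CL X) {ε : ℝ} (hε : 0 < ε) : IsOpen (A.1 ∪ thickening ε (A.1 ∩ NI X)) := by
    have : A.1 ∪ thickening ε (A.1 ∩ NI X) =
        (⋃ x ∈ A.1 \ NI X, {x}) ∪ thickening ε (A.1 ∩ NI X) := by
      rw [biUnion_of_singleton]
      have := self_subset_thickening hε (A.1 ∩ NI X)
      ext x
      by_cases hx : x ∈ NI X
      · have := @this x
        simp only [mem_union, Set.mem_sdiff, mem_inter_iff] at *
        tauto
      · simp [hx]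
    rw [this]
    exact (isOpen_biUnion fun x hx => by simpa [NI] using hx.2).union isOpen_thickening
  -- The alternative `1 ≤ ε` caps the distance at 1. Smaller `ε` tests more of the sets `O n`.
  refine QuasiMetrizable.of_relations (fun ε A B => 1 ≤ ε ∨
    B.1 ⊆ A.1 ∪ thickening ε (A.1 ∩ NI X) ∧
      ∀ n : ℕ, ε ≤ (1 / 2) ^ n → (A.1 ∩ O n).Nonempty → (B.1 ∩ O n).Nonempty)
    (fun ε A _ => Or.inr ⟨subset_union_left, fun _ _ h => h⟩) (fun A B => Or.inl le_rfl)
    ?_ ?_ ?_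
  · rintro ε δ A B C hε hδ (h | ⟨hAB, hAB'⟩) hBC
    · exact Or.inl (by linarith)
    rcases hBC with h | ⟨hBC, hBC'⟩
    · exact Or.inl (by linarith)
    refine Or.inr ⟨fun c hc => ?_,
      fun n hn h => hBC' n (by linarith) (hAB' n (by linarith) h)⟩
    rcases hBC hc with hcB | hcB
    · exact (hAB hcB).imp_right fun h => thickening_mono (by linarith) _ h
    · obtain ⟨b, ⟨hbB, hbK⟩, hcb⟩ := mem_thickening_iff.1 hcB
      refine Or.inr (mem_thickening_iff.2 ?_)
      -- As `b` is non-isolated, `b ∈ A` puts it in `A ∩ NI X`, where thickening is allowed.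
      rcases hAB hbB with hbA | hbA
      · exact ⟨b, ⟨hbA, hbK⟩, by linarith⟩
      · obtain ⟨a, ha, hba⟩ := mem_thickening_iff.1 hbA
        exact ⟨a, ha, by linarith [dist_triangle c b a]⟩
  · rintro ε δ A B hε hεδ (h | ⟨h, h'⟩)
    · exact Or.inl (h.trans hεδ)
    · exact Or.inr ⟨h.trans (union_subset_union_right _ (thickening_mono hεδ _)),
        fun n hn => h' n (hεδ.trans hn)⟩
  · intro A
    refine ⟨fun s => ⟨fun hs => ?_, ?_⟩⟩
    · obtain ⟨W, hWs, hW, hAW⟩ := mem_nhds_iff.1 hs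
      obtain ⟨u, hu, huo, hAu, huW⟩ := CL.exists_basic_subset hW hAW
      obtain ⟨ε, hε, hεu⟩ := (hK.inter_left A.2.1).exists_thickening_subset_open
        (isOpen_sUnion huo) (inter_subset_left.trans hAu.1)
      have hn : ∀ U ∈ u, ∃ n, (A.1 ∩ O n).Nonempty ∧ O n ⊆ U := by
        intro U hU
        obtain ⟨a, haA, haU⟩ := hAu.2 U hU
        obtain ⟨_, ⟨n, rfl⟩, han, hnU⟩ := hO.exists_subset_of_mem_open haU (huo U hU)
        exact ⟨n, ⟨a, haA, han⟩, hnU⟩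
      choose! n hnA hnU using hn
      have hev : ∀ᶠ δ : ℝ in 𝓝[>] 0, 0 < δ ∧ δ < 1 ∧ δ < ε ∧ ∀ U ∈ u, δ < (1 / 2) ^ n U := by
        refine eventually_mem_nhdsWithin.and ?_
        refine (eventually_nhdsWithin_of_eventually_nhds (eventually_lt_nhds one_pos)).and ?_
        refine (eventually_nhdsWithin_of_eventually_nhds (eventually_lt_nhds hε)).and ?_
        exact hu.eventually_all.2 fun U _ =>
          eventually_nhdsWithin_of_eventually_nhds (eventually_lt_nhds (by positivity))
      obtain ⟨δ, hδ, hδ1, hδε, hδu⟩ := hev.exists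
      refine ⟨δ, hδ, fun B hB => hWs (huW ?_)⟩
      rcases hB with h | ⟨hB, hB'⟩
      · exact (hδ1.not_ge h).elim
      · exact ⟨hB.trans (union_subset hAu.1 ((thickening_mono hδε.le _).trans hεu)),
          fun U hU => (hB' (n U) (hδu U hU).le (hnA U hU)).mono
            (inter_subset_inter_right _ (hnU U hU))⟩
    · rintro ⟨ε, hε, hs⟩
      obtain ⟨N, hN⟩ := exists_pow_lt_of_lt_one hε (by norm_num : (1 / 2 : ℝ) < 1)
      have h1 : {B : CL X | B.1 ⊆ A.1 ∪ thickening ε (A.1 ∩ NI X)} ∈ 𝓝 A :=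
        (CL.isOpen_subset (hopen A hε)).mem_nhds subset_union_left
      have h2 : ∀ n ∈ Iio N, {B : CL X | (A.1 ∩ O n).Nonempty → (B.1 ∩ O n).Nonempty} ∈ 𝓝 A := by
        intro n _
        by_cases h : (A.1 ∩ O n).Nonempty
        · simpa [h] using (CL.isOpen_hits (hOo n)).mem_nhds h
        · simp [h]
      refine mem_of_superset (inter_mem h1 ((biInter_mem (finite_Iio N)).2 h2)) fun B hB => hs ?_
      refine Or.inr ⟨hB.1, fun n hn => mem_iInter₂.1 hB.2 n ?_⟩
      by_contra hnN
      have := pow_le_pow_of_le_one (by norm_num) (by norm_num : (1 / 2 : ℝ) ≤ 1) (not_lt.1 hnN)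
      linarith

/-! ### The counterexample -/

/-- The metric fan: a vertex together with isolated points `point n m` at distance `1 / (n + 1)`
from it. -/
inductive MetricFan : Type
  | vertex : MetricFan
  | point : ℕ → ℕ → MetricFan

namespace MetricFan

/-- The distance to the vertex. -/
noncomputable def height : MetricFan → ℝ
  | vertex => 0
  | point n _ => 1 / (n + 1)

theorem height_point_pos (n m : ℕ) : 0 < height (point n m) := by
  simp only [height]; positivity

theorem height_nonneg : ∀ x, 0 ≤ height x
  | vertex => le_rfl
  | point n m => (height_point_pos n m).le

open Classical in
noncomputable instance : MetricSpace MetricFan where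
  dist x y := if x = y then 0 else max (height x) (height y)
  dist_self x := if_pos rfl
  dist_comm x y := by simp only [eq_comm, max_comm]
  dist_triangle x y z := by
    have hx := height_nonneg x
    have hy := height_nonneg y
    have hz := height_nonneg z
    grind
  eq_of_dist_eq_zero {x y} h := by
    by_contra hxy
    simp only [hxy, if_false] at h
    have hx : height x ≤ 0 := h ▸ le_max_left _ _
    have hy : height y ≤ 0 := h ▸ le_max_right _ _
    rcases x with _ | ⟨n, m⟩
    · rcases y with _ | ⟨n, m⟩
      · exact hxy rfl
      · exact (height_point_pos n m).not_ge hy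
    · exact (height_point_pos n m).not_ge hx

theorem dist_of_ne {x y : MetricFan} (h : x ≠ y) : dist x y = max (height x) (height y) :=
  if_neg h

instance : Countable MetricFan := by
  let f : MetricFan → Option (ℕ × ℕ)
    | vertex => none
    | point n m => some (n, m)
  refine Function.Injective.countable (f := f) fun x y h => ?_
  rcases x with _ | ⟨n, m⟩ <;> rcases y with _ | ⟨k, l⟩ <;> simp_all [f]

theorem isOpen_singleton_point (n m : ℕ) : IsOpen {point n m} := by
  refine Metric.isOpen_singleton_iff.2 ⟨_, height_point_pos n m, fun y hy => ?_⟩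
  by_contra hne
  rw [dist_of_ne hne] at hy
  exact (le_max_right _ _).not_gt hy

theorem isCompact_NI : IsCompact (NI MetricFan) := by
  refine Set.Subsingleton.isCompact fun x hx y hy => ?_
  rcases x with _ | ⟨n, m⟩
  · rcases y with _ | ⟨n, m⟩
    · rfl
    · exact (hy (isOpen_singleton_point n m)).elim
  · exact (hx (isOpen_singleton_point n m)).elim

theorem exists_row_subset {U : Set MetricFan} (hU : U ∈ 𝓝 vertex) :
    ∃ n : ℕ, ∀ m : ℕ, point n m ∈ U := by
  obtain ⟨ε, hε, hεU⟩ := Metric.mem_nhds_iff.1 hU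
  obtain ⟨n, hn⟩ := exists_nat_one_div_lt hε
  refine ⟨n, fun m => hεU ?_⟩
  rw [Metric.mem_ball, dist_of_ne (by simp)]
  exact max_lt hn hε

/-- A neighbourhood of the vertex contains a whole row, whose points have constant positive mutual
distance, so no subsequence is Cauchy. -/
theorem not_isCompact_of_mem_nhds {U : Set MetricFan} (hU : U ∈ 𝓝 vertex) : ¬ IsCompact U := by
  intro hc
  obtain ⟨n, hn⟩ := exists_row_subset hU
  obtain ⟨a, -, φ, hφ, ha⟩ := hc.tendsto_subseq hn
  obtain ⟨N, hN⟩ := Metric.cauchySeq_iff.1 ha.cauchySeq _ (height_point_pos n 0)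
  have h := hN N le_rfl (N + 1) N.le_succ
  have hne : point n (φ N) ≠ point n (φ (N + 1)) := by
    simpa using (hφ N.lt_succ_self).ne
  rw [Function.comp_apply, Function.comp_apply, dist_of_ne hne] at h
  exact (le_max_left _ _).not_gt h

/-- In `C` the vertex would have a compact neighbourhood; in `D` it would be isolated. -/
theorem not_isCompactSumCountableDiscrete : ¬ IsCompactSumCountableDiscrete MetricFan := by
  rintro ⟨C, D, _, _, _, -, -, _, ⟨e⟩⟩
  rcases he : e vertex with c | d
  · refine not_isCompact_of_mem_nhds (U := e ⁻¹' range Sum.inl) ?_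
      (e.isCompact_preimage.2 (isCompact_range continuous_inl))
    exact (isOpen_range_inl.preimage e.continuous).mem_nhds ⟨c, he.symm⟩
  · have ho : IsOpen (e ⁻¹' {Sum.inr d}) := by
      have : IsOpen (Sum.inr '' {d} : Set (C ⊕ D)) := isOpenMap_inr _ (isOpen_discrete _)
      rw [image_singleton] at this
      exact this.preimage e.continuous
    obtain ⟨n, hn⟩ := exists_row_subset (ho.mem_nhds he)
    have := e.injective ((hn 0).trans he.symm)
    simp at this

end MetricFan

theorem theorem2p5 (X : Type*) [TopologicalSpace X] [T2Space X] :
    List.TFAE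
      [ QuasiMetrizable (CL X),
        IsGammaSpace (CL X),
        ∀ K : Set (CL X), IsClosed K → IsCountablyCompact K → HasCountableBaseIn K,
        SeparableSpace X ∧ MetrizableSpace X ∧ IsCompact (NI X) ] ∧
    ∃ (Y : Type) (_ : TopologicalSpace Y), T2Space Y ∧
      QuasiMetrizable (CL Y) ∧ ¬ IsCompactSumCountableDiscrete Y := by
  refine ⟨?_, MetricFan, inferInstance, inferInstance, quasiMetrizable_CL MetricFan.isCompact_NI,
    MetricFan.not_isCompactSumCountableDiscrete⟩
  tfae_have 1 → 2 := QuasiMetrizable.isGammaSpace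
  tfae_have 2 → 3 := fun h _ _ hK => h.hasCountableBaseIn hK
  tfae_have 3 → 4 := separable_metrizable_isCompact_NI
  tfae_have 4 → 1 := fun ⟨_, _, hK⟩ => quasiMetrizable_CL hK
  tfae_finish
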